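/- Let $\Gamma$ be the set of bounded $C^1$ functions $g:\mathbb{R}\to\mathbb{R}$ whose derivative $g'$ is $1$-Lipschitz. For Borel probability measures $\mu,\nu,\gamma$ on $\mathbb{R}$ put $$G_\Gamma(\mu\|\nu)=\sup_{g\in\Gamma}\Big\{\int g\,d\mu-\log\int e^{g}\,d\nu\Big\},\qquad W_\Gamma(\mu-\gamma)=\sup_{g\in\Gamma}\int g\,d(\mu-\gamma),$$ and let $R(\gamma\|\nu)=\int\log\frac{d\gamma}{d\nu}\,d\gamma$ if $\gamma\ll\nu$, and $R(\gamma\|\nu)=\infty$ otherwise, denote relative entropy. Let $\mu=N(b_1,\sigma_1^2)$ and $\nu=N(b_2,\sigma_2^2)$ with $b_1,b_2\in\mathbb{R}$ and $\sigma_1,\sigma_2>0$. Then there is a unique Borel probability measure $\gamma^*$ on $\mathbb{R}$ that attains the infimum in $$G_\Gamma(\mu\|\nu)=\inf_{\gamma}\big\{R(\gamma\|\nu)+W_\Gamma(\mu-\gamma)\big\},$$ where $\gamma$ ranges over all Borel probability measures on $\mathbb{R}$ (in particular this identity holds). Moreover: (i) if $\left|\frac1{\sigma_1^2}-\frac1{\sigma_2^2}\right|\le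 1$, then $\gamma^*=\mu=N(b_1,\sigma_1^2)$, and hence $G_\Gamma(\mu\|\nu)=R(\mu\|\nu)$; (ii) if $\frac1{\sigma_1^2}-\frac1{\sigma_2^2}>1$, then $\gamma^*=N\!\left(b_1,\frac{\sigma_2^2}{1+\sigma_2^2}\right)$; (iii) if $\frac1{\sigma_1^2}-\frac1{\sigma_2^2}<-1$, then $\gamma^*=N\!\left(b_1,\frac{\sigma_2^2}{1-\sigma_2^2}\right)$. -/

import Mathlib

open MeasureTheory ProbabilityTheory InformationTheory
open scoped BoundedContinuousFunction

noncomputable section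

namespace GammaDivergence

variable {S : Type*} [TopologicalSpace S] [MeasurableSpace S]

/-- The `Γ`-divergence `G_Γ(μ‖ν) = sup_{g ∈ Γ} {∫ g dμ - log ∫ e^g dν}` in the extended reals. -/
def divergence (Γ : Set (S →ᵇ ℝ)) (μ ν : ProbabilityMeasure S) : EReal :=
  ⨆ g ∈ Γ, ((∫ x, g x ∂(μ : Measure S) - Real.log (∫ x, Real.exp (g x) ∂(ν : Measure S)) : ℝ) :
    EReal)

/-- `W_Γ(μ - γ) = sup_{g ∈ Γ} ∫ g d(μ - γ)` in the extended reals. As `g` is bounded and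
`μ`, `γ` are finite, the integral against `μ - γ` is the difference of the two integrals. -/
def W (Γ : Set (S →ᵇ ℝ)) (μ γ : ProbabilityMeasure S) : EReal :=
  ⨆ g ∈ Γ, ((∫ x, g x ∂(μ : Measure S) - ∫ x, g x ∂(γ : Measure S) : ℝ) : EReal)

/-- Relative entropy `R(γ‖ν)`: the integral of `log (dγ/dν)` against `γ` if `γ ≪ ν` and this
integral is finite, and `∞` otherwise. -/
def relEntropy (γ ν : ProbabilityMeasure S) : EReal :=
  ((klDiv (γ : Measure S) (ν : Measure S) : ENNReal) : EReal)

/-- The functional `γ ↦ R(γ‖ν) + W_Γ(μ - γ)` whose infimum over all probability measures `γ`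
is the inf-convolution. -/
def objective (Γ : Set (S →ᵇ ℝ)) (μ ν γ : ProbabilityMeasure S) : EReal :=
  relEntropy γ ν + W Γ μ γ

/-- `γ` attains the infimum of `R(·‖ν) + W_Γ(μ - ·)` over all probability measures. -/
def IsOptimizer (Γ : Set (S →ᵇ ℝ)) (μ ν γ : ProbabilityMeasure S) : Prop :=
  ∀ γ' : ProbabilityMeasure S, objective Γ μ ν γ ≤ objective Γ μ ν γ'

/-- The bounded `C¹` functions on `ℝ` with 1-Lipschitz derivative. -/
def lipDerivClass : Set (ℝ →ᵇ ℝ) :=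
  {g | ContDiff ℝ 1 (g : ℝ → ℝ) ∧ LipschitzWith 1 (deriv (g : ℝ → ℝ))}

/-- The normal distribution `N(b, v)` with mean `b` and variance `v`; only used for `v > 0`. -/
def normal (b v : ℝ) : ProbabilityMeasure ℝ :=
  ⟨gaussianReal b v.toNNReal, inferInstance⟩

end GammaDivergence

end

noncomputable section

namespace GammaDivergence

open Filter Topology

/-! Write `u`, `v` for the variances of μ, ν and `s` for that of the candidate γ* = N(b₁, s). The
log-density q of γ* relative to ν is a quadratic with q'' = c = 1/v - 1/s. If |c| ≤ 1, then q is, up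
to boundedness, an element of Γ, and it is the dual optimizer. Upper bound: R(γ*‖ν) = ∫ q dγ*, and
`W_normal_le` gives W(μ - γ*) ≤ |u - s|/2. When c(u - s) = |u - s|, the sum is D = ∫ q dμ. Lower
bound: the Donsker–Varadhan inequality with test function g + f, g ∈ Γ tending to q, gives ∫ f dγ +
D - log ∫ e^f dγ* ≤ R(γ‖ν) + W(μ - γ) for every γ and bounded f. Taking f = 0 gives optimality;
letting f vary forces any optimizer to equal γ*. The same g shows that the divergence is at least D.
The three cases choose s = u, c = -1 and c = 1. -/

/-! ### Gaussian moments and the bound on W -/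

theorem integral_sq_gaussianReal (b : ℝ) (v : NNReal) :
    ∫ x, x ^ 2 ∂gaussianReal b v = v + b ^ 2 := by
  have h := variance_eq_sub (memLp_id_gaussianReal (μ := b) (v := v) 2)
  rw [variance_id_gaussianReal] at h
  simp only [Pi.pow_apply, id_eq, integral_id_gaussianReal] at h
  linarith

theorem integrable_id_gaussianReal (b : ℝ) (v : NNReal) :
    Integrable (fun x : ℝ => x) (gaussianReal b v) :=
  (memLp_id_gaussianReal 1).integrable le_rfl

theorem integrable_sq_gaussianReal (b : ℝ) (v : NNReal) :
    Integrable (fun x : ℝ => x ^ 2) (gaussianReal b v) :=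
  (memLp_id_gaussianReal (μ := b) (v := v) 2).integrable_sq

/-- Quadratic lower bound for a function with 1-Lipschitz derivative. -/
theorem add_deriv_mul_sub_sq_le {g : ℝ → ℝ} (hg : Differentiable ℝ g)
    (hL : LipschitzWith 1 (deriv g)) (x z : ℝ) :
    g x + deriv g x * z - z ^ 2 / 2 ≤ g (x + z) := by
  -- Adding y²/2 makes the derivative monotone, so the claim is the tangent-line inequality of a
  -- convex function.
  have hd : ∀ y, HasDerivAt (fun y => g y + y ^ 2 / 2) (deriv g y + y) y := fun y => by
    have h := (hg y).hasDerivAt.add ((hasDerivAt_pow 2 y).div_const 2)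
    norm_num at h
    exact h
  have hconv : ConvexOn ℝ Set.univ (fun y => g y + y ^ 2 / 2) := by
    refine MonotoneOn.convexOn_of_deriv convex_univ
      (fun y _ => (hd y).continuousAt.continuousWithinAt)
      (fun y _ => (hd y).differentiableAt.differentiableWithinAt) ?_
    intro a _ c _ hac
    rw [(hd a).deriv, (hd c).deriv]
    have := hL.dist_le_mul a c
    rw [Real.dist_eq, Real.dist_eq, abs_sub_comm a c, abs_of_nonneg (sub_nonneg.2 hac)] at this
    have := le_abs_self (deriv g a - deriv g c)
    norm_num at *
    linarith
  rcases lt_trichotomy z 0 with hz | rfl | hz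
  · have h := hconv.slope_le_of_hasDerivAt (Set.mem_univ (x + z)) (Set.mem_univ x)
      (by linarith) (hd x)
    rw [slope_def_field, div_le_iff₀ (by linarith)] at h
    nlinarith
  · simp
  · have h := hconv.le_slope_of_hasDerivAt (Set.mem_univ x) (Set.mem_univ (x + z))
      (by linarith) (hd x)
    rw [slope_def_field, le_div_iff₀ (by linarith)] at h
    nlinarith

/-- N(b, v + d) is the law of X + Z with independent X ~ N(b, v), Z ~ N(0, d). In the quadratic
lower bound at X the linear term averages to 0 and the square costs d/2. -/
theorem integral_gaussianReal_sub_le (g : ℝ →ᵇ ℝ) (hg : g ∈ lipDerivClass) (b : ℝ)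
    (v d : NNReal) :
    ∫ x, g x ∂gaussianReal b v - d / 2 ≤ ∫ x, g x ∂gaussianReal b (v + d) := by
  have hconv : gaussianReal b (v + d) =
      ((gaussianReal b v).prod (gaussianReal 0 d)).map (fun p : ℝ × ℝ => p.1 + p.2) := by
    have h := gaussianReal_conv_gaussianReal (m₁ := b) (m₂ := 0) (v₁ := v) (v₂ := d)
    rw [add_zero] at h
    exact h.symm
  have hint : Integrable (fun p : ℝ × ℝ => g (p.1 + p.2))
      ((gaussianReal b v).prod (gaussianReal 0 d)) :=
    (g.compContinuous ⟨fun p : ℝ × ℝ => p.1 + p.2, by fun_prop⟩).integrable _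
  rw [hconv, integral_map (by fun_prop) (g.continuous.aestronglyMeasurable),
    integral_prod _ hint]
  have hgi : ∀ (m : Measure ℝ) [IsFiniteMeasure m], Integrable g m := fun m _ => g.integrable m
  calc ∫ x, g x ∂gaussianReal b v - d / 2 = ∫ x, (g x - d / 2) ∂gaussianReal b v := by
        rw [integral_sub (hgi _) (integrable_const _)]; simp
    _ ≤ _ := by
        refine integral_mono ((hgi _).sub (integrable_const _)) hint.integral_prod_left fun x => ?_
        have h1 := integrable_id_gaussianReal 0 d
        have h2 := integrable_sq_gaussianReal 0 d
        calc g x - d / 2 = ∫ z, (g x + deriv g x * z - z ^ 2 / 2) ∂gaussianReal 0 d := by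
              have h3 : Integrable (fun z : ℝ => g x + deriv g x * z) (gaussianReal 0 d) :=
                (integrable_const _).add (h1.const_mul _)
              rw [integral_sub h3 (h2.div_const _), integral_add (integrable_const _)
                (h1.const_mul _), integral_const_mul, integral_div, integral_sq_gaussianReal,
                integral_id_gaussianReal]
              simp
          _ ≤ _ := integral_mono (((integrable_const _).add (h1.const_mul _)).sub
                (h2.div_const _))
                ((g.compContinuous ⟨fun z : ℝ => x + z, by fun_prop⟩).integrable _)
                (fun z => add_deriv_mul_sub_sq_le (hg.1.differentiable one_ne_zero) hg.2 x z)

theorem neg_mem_lipDerivClass {g : ℝ →ᵇ ℝ} (hg : g ∈ lipDerivClass) : -g ∈ lipDerivClass := by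
  refine ⟨hg.1.neg, ?_⟩
  have : deriv (⇑(-g)) = -deriv g := by
    ext x
    exact deriv.neg
  rw [this]
  exact hg.2.neg

theorem W_normal_le (b : ℝ) {v s : ℝ} (hv : 0 ≤ v) (hs : 0 ≤ s) :
    W lipDerivClass (normal b v) (normal b s) ≤ ((|v - s| / 2 : ℝ) : EReal) := by
  refine iSup₂_le fun g hg => EReal.coe_le_coe_iff.2 ?_
  change ∫ x, g x ∂gaussianReal b v.toNNReal - ∫ x, g x ∂gaussianReal b s.toNNReal ≤ _
  rcases le_total v s with h | h
  · have h1 := integral_gaussianReal_sub_le g hg b v.toNNReal (s - v).toNNReal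
    rw [← Real.toNNReal_add hv (by linarith), add_sub_cancel, Real.coe_toNNReal _ (by linarith)] at h1
    rw [abs_of_nonpos (by linarith)]
    linarith
  · have h1 := integral_gaussianReal_sub_le (-g) (neg_mem_lipDerivClass hg) b s.toNNReal
      (v - s).toNNReal
    rw [← Real.toNNReal_add hs (by linarith), add_sub_cancel, Real.coe_toNNReal _ (by linarith)] at h1
    simp only [BoundedContinuousFunction.coe_neg, Pi.neg_apply, integral_neg] at h1
    rw [abs_of_nonneg (by linarith)]
    linarith

/-! ### Relative entropy and weak duality -/

section
variable {S : Type*} [MeasurableSpace S]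

theorem relEntropy_eq_integral_llr {γ ν : ProbabilityMeasure S}
    (h : klDiv (γ : Measure S) (ν : Measure S) ≠ ⊤) :
    relEntropy γ ν = ((∫ x, llr (γ : Measure S) (ν : Measure S) x ∂(γ : Measure S) : ℝ) : EReal) := by
  have hac := (klDiv_ne_top_iff.1 h).1
  rw [← toReal_klDiv_of_measure_eq hac (by simp), ← EReal.toReal_coe_ennreal, EReal.coe_toReal]
  · rfl
  · simpa using h
  · simp

/-- The easy half of the Donsker–Varadhan formula, for bounded measurable functions. -/
theorem integral_sub_log_le_relEntropy (γ ν : ProbabilityMeasure S) {f : S → ℝ}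
    (hf : Measurable f) {C : ℝ} (hC : ∀ x, |f x| ≤ C) :
    ((∫ x, f x ∂(γ : Measure S) - Real.log (∫ x, Real.exp (f x) ∂(ν : Measure S)) : ℝ) : EReal)
      ≤ relEntropy γ ν := by
  by_cases h : klDiv (γ : Measure S) (ν : Measure S) = ⊤
  · simp [relEntropy, h]
  obtain ⟨hac, hint⟩ := klDiv_ne_top_iff.1 h
  rw [relEntropy_eq_integral_llr h, EReal.coe_le_coe_iff]
  have hfi : Integrable f (γ : Measure S) :=
    .of_bound hf.aestronglyMeasurable C (.of_forall hC)
  have hei : Integrable (fun x => Real.exp (f x)) (ν : Measure S) :=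
    .of_bound hf.exp.aestronglyMeasurable (Real.exp C) (.of_forall fun x => by
      rw [Real.norm_of_nonneg (Real.exp_pos _).le]
      exact Real.exp_le_exp.2 ((le_abs_self _).trans (hC x)))
  have : IsProbabilityMeasure ((ν : Measure S).tilted f) := isProbabilityMeasure_tilted hei
  have hac' : (γ : Measure S) ≪ (ν : Measure S).tilted f :=
    hac.trans (absolutelyContinuous_tilted hei)
  -- Nonnegativity of the entropy of γ relative to the tilted measure is the claim.
  have h1 := integral_llr_tilted_right hac hfi hei hint
  have h2 := integral_llr_add_sub_measure_univ_nonneg hac'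
    (integrable_llr_tilted_right hac hfi hint hei)
  simp only [probReal_univ, add_sub_cancel_right] at h2
  linarith

/-- The terms ∫ g dγ cancel between entropy and W. The free f, not restricted to Γ, is what later
identifies the optimizer. -/
theorem le_objective [TopologicalSpace S] [OpensMeasurableSpace S] {Γ : Set (S →ᵇ ℝ)} (μ ν γ : ProbabilityMeasure S)
    {g : S →ᵇ ℝ} (hg : g ∈ Γ) {f : S → ℝ} (hf : Measurable f) {C : ℝ} (hC : ∀ x, |f x| ≤ C) :
    ((∫ x, f x ∂(γ : Measure S) + ∫ x, g x ∂(μ : Measure S) -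
      Real.log (∫ x, Real.exp (g x + f x) ∂(ν : Measure S)) : ℝ) : EReal) ≤
      objective Γ μ ν γ := by
  have h1 := integral_sub_log_le_relEntropy γ ν (f := fun x => g x + f x)
    (g.continuous.measurable.add hf) (C := ‖g‖ + C)
    (fun x => (abs_add_le _ _).trans (add_le_add (g.norm_coe_le_norm x) (hC x)))
  have h2 : ((∫ x, g x ∂(μ : Measure S) - ∫ x, g x ∂(γ : Measure S) : ℝ) : EReal) ≤ W Γ μ γ :=
    le_iSup₂_of_le g hg le_rfl
  refine le_trans (le_of_eq ?_) (add_le_add h1 h2)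
  rw [← EReal.coe_add, integral_add (g.integrable _)
    (.of_bound hf.aestronglyMeasurable C (.of_forall hC))]
  congr 1
  ring

end

/-! ### Approximating quadratics inside Γ -/

/-- A bounded smooth approximation of `x ↦ c * x ^ 2 / 2 + β * x + δ`, as `t → 0`. -/
def quadApprox (c β δ t : ℝ) : ℝ →ᵇ ℝ :=
  BoundedContinuousFunction.ofNormedAddCommGroup
    (fun x => (1 + |β| * t)⁻¹ * (c * ((1 - Real.cos (t * x)) / t ^ 2) + β * (Real.sin (t * x) / t)) + δ)
    (by fun_prop) (|(1 + |β| * t)⁻¹| * (|c| * (2 / t ^ 2) + |β| * (1 / |t|)) + |δ|) (fun x => by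
      refine (abs_add_le _ _).trans (add_le_add ?_ le_rfl)
      rw [abs_mul]
      gcongr
      refine (abs_add_le _ _).trans ?_
      rw [abs_mul, abs_mul, abs_div, abs_div, abs_of_nonneg (sq_nonneg t)]
      gcongr
      · rw [abs_le]
        constructor <;> linarith [Real.cos_le_one (t * x), Real.neg_one_le_cos (t * x)]
      · exact Real.abs_sin_le_one _)

theorem quadApprox_apply (c β δ t x : ℝ) : quadApprox c β δ t x =
    (1 + |β| * t)⁻¹ * (c * ((1 - Real.cos (t * x)) / t ^ 2) + β * (Real.sin (t * x) / t)) + δ :=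
  rfl

theorem hasDerivAt_quadApprox (c β δ : ℝ) {t : ℝ} (ht : 0 < t) (x : ℝ) :
    HasDerivAt (quadApprox c β δ t)
      ((1 + |β| * t)⁻¹ * (c * (Real.sin (t * x) / t) + β * Real.cos (t * x))) x := by
  have h0 : HasDerivAt (fun x => t * x) t x := by simpa using (hasDerivAt_id x).const_mul t
  have h := (((((h0.cos.const_sub 1).div_const (t ^ 2)).const_mul c).add
    ((h0.sin.div_const t).const_mul β)).const_mul (1 + |β| * t)⁻¹).add_const δ
  refine h.congr_deriv ?_
  field_simp

/-- Before normalization the second derivative is c cos(tx) - βt sin(tx), of size at most 1 + |β|t;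
the prefactor compensates exactly. -/
theorem quadApprox_mem {c : ℝ} (hc : |c| ≤ 1) (β δ : ℝ) {t : ℝ} (ht : 0 < t) :
    quadApprox c β δ t ∈ lipDerivClass := by
  have hpos : 0 < 1 + |β| * t := by positivity
  constructor
  · change ContDiff ℝ 1 fun x =>
      (1 + |β| * t)⁻¹ * (c * ((1 - Real.cos (t * x)) / t ^ 2) + β * (Real.sin (t * x) / t)) + δ
    fun_prop
  · refine LipschitzWith.of_dist_le_mul fun x y => ?_
    rw [(hasDerivAt_quadApprox c β δ ht x).deriv, (hasDerivAt_quadApprox c β δ ht y).deriv,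
      Real.dist_eq, Real.dist_eq, ← mul_sub, abs_mul, abs_of_pos (inv_pos.2 hpos),
      inv_mul_le_iff₀ hpos, NNReal.coe_one, one_mul]
    have hs : |Real.sin (t * x) - Real.sin (t * y)| ≤ t * |x - y| := by
      have := Real.abs_sin_sub_sin_le (t * x) (t * y)
      rwa [← mul_sub, abs_mul, abs_of_pos ht] at this
    have hk : |Real.cos (t * x) - Real.cos (t * y)| ≤ t * |x - y| := by
      have := Real.abs_cos_sub_cos_le (t * x) (t * y)
      rwa [← mul_sub, abs_mul, abs_of_pos ht] at this
    calc |c * (Real.sin (t * x) / t) + β * Real.cos (t * x) -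
          (c * (Real.sin (t * y) / t) + β * Real.cos (t * y))|
        = |c * ((Real.sin (t * x) - Real.sin (t * y)) / t) +
            β * (Real.cos (t * x) - Real.cos (t * y))| := by congr 1; ring
      _ ≤ |c| * (|Real.sin (t * x) - Real.sin (t * y)| / t) +
            |β| * |Real.cos (t * x) - Real.cos (t * y)| := by
          refine (abs_add_le _ _).trans_eq ?_
          rw [abs_mul, abs_mul, abs_div, abs_of_pos ht]
      _ ≤ 1 * (t * |x - y| / t) + |β| * (t * |x - y|) := by gcongr
      _ = (1 + |β| * t) * |x - y| := by field_simp

theorem tendsto_quadApprox (c β δ x : ℝ) :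
    Tendsto (fun t => quadApprox c β δ t x) (𝓝[>] 0) (𝓝 (c * x ^ 2 / 2 + β * x + δ)) := by
  have h : Tendsto (fun t : ℝ => (1 + |β| * t)⁻¹ *
      (c * (x ^ 2 / 2 * Real.sinc (t * x / 2) ^ 2) + β * (x * Real.sinc (t * x))) + δ)
      (𝓝 0) (𝓝 (c * x ^ 2 / 2 + β * x + δ)) := by
    have hs := Real.continuous_sinc
    have : ContinuousAt (fun t : ℝ => (1 + |β| * t)⁻¹ *
      (c * (x ^ 2 / 2 * Real.sinc (t * x / 2) ^ 2) + β * (x * Real.sinc (t * x))) + δ) 0 := by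
      refine ContinuousAt.add (ContinuousAt.mul (ContinuousAt.inv₀ (by fun_prop) (by simp)) ?_)
        continuousAt_const
      fun_prop
    convert this.tendsto using 2
    simp
    ring
  refine (h.mono_left nhdsWithin_le_nhds).congr' ?_
  filter_upwards [self_mem_nhdsWithin] with t ht
  have ht : 0 < t := ht
  rw [quadApprox_apply]
  rcases eq_or_ne x 0 with rfl | hx
  · simp
  rw [Real.sinc_of_ne_zero (by positivity), Real.sinc_of_ne_zero (by positivity)]
  have : Real.cos (t * x) = 1 - 2 * Real.sin (t * x / 2) ^ 2 := by
    rw [show t * x = 2 * (t * x / 2) by ring, Real.cos_two_mul, Real.cos_sq']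
    ring_nf
  rw [this]
  congr 2
  field_simp
  ring

theorem inv_mem_Icc (β : ℝ) {t : ℝ} (ht : 0 < t) :
    0 ≤ (1 + |β| * t)⁻¹ ∧ (1 + |β| * t)⁻¹ ≤ 1 :=
  ⟨by positivity, inv_le_one_of_one_le₀ (by have : 0 ≤ |β| * t := by positivity
                                            linarith)⟩

theorem one_sub_cos_div_mem_Icc {t : ℝ} (ht : 0 < t) (x : ℝ) :
    0 ≤ (1 - Real.cos (t * x)) / t ^ 2 ∧ (1 - Real.cos (t * x)) / t ^ 2 ≤ x ^ 2 / 2 := by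
  refine ⟨div_nonneg (by linarith [Real.cos_le_one (t * x)]) (by positivity), ?_⟩
  rw [div_le_iff₀ (by positivity)]
  nlinarith [Real.one_sub_sq_div_two_le_cos (x := t * x)]

theorem abs_sin_div_le {t : ℝ} (ht : 0 < t) (x : ℝ) : |Real.sin (t * x) / t| ≤ |x| := by
  rw [abs_div, abs_of_pos ht, div_le_iff₀ ht]
  refine (Real.abs_sin_le_abs).trans_eq ?_
  rw [abs_mul, abs_of_pos ht, mul_comm]

/-- A one-sided bound is needed to dominate exponentials: only c < 1/v is available, and |c| may
exceed 1/v. -/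
theorem quadApprox_le {c κ : ℝ} (hκ : 0 ≤ κ) (hc : c ≤ κ) (β δ : ℝ) {t : ℝ} (ht : 0 < t) (x : ℝ) :
    quadApprox c β δ t x ≤ κ * x ^ 2 / 2 + |β| * |x| + δ := by
  rw [quadApprox_apply]
  obtain ⟨h1, h2⟩ := one_sub_cos_div_mem_Icc ht x
  obtain ⟨i0, i1⟩ := inv_mem_Icc β ht
  have h3 : β * (Real.sin (t * x) / t) ≤ |β| * |x| := by
    refine (le_abs_self _).trans ?_
    rw [abs_mul]
    exact mul_le_mul_of_nonneg_left (abs_sin_div_le ht x) (abs_nonneg β)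
  have h4 : c * ((1 - Real.cos (t * x)) / t ^ 2) ≤ κ * (x ^ 2 / 2) := by gcongr
  have h5 : 0 ≤ κ * (x ^ 2 / 2) + |β| * |x| := by positivity
  nlinarith

theorem abs_quadApprox_le (c β δ : ℝ) {t : ℝ} (ht : 0 < t) (x : ℝ) :
    |quadApprox c β δ t x| ≤ |c| * x ^ 2 / 2 + |β| * |x| + |δ| := by
  rw [quadApprox_apply]
  obtain ⟨h1, h2⟩ := one_sub_cos_div_mem_Icc ht x
  obtain ⟨i0, i1⟩ := inv_mem_Icc β ht
  refine (abs_add_le _ _).trans (add_le_add ?_ le_rfl)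
  rw [abs_mul, abs_of_nonneg i0]
  refine (mul_le_of_le_one_left (abs_nonneg _) i1).trans ((abs_add_le _ _).trans ?_)
  rw [abs_mul, abs_mul, abs_of_nonneg h1, mul_div_assoc]
  exact add_le_add (mul_le_mul_of_nonneg_left h2 (abs_nonneg c))
    (mul_le_mul_of_nonneg_left (abs_sin_div_le ht x) (abs_nonneg β))

/-! ### Gaussian densities and limits of integrals -/

theorem integrable_exp_quad_add_abs {a : ℝ} (ha : 0 < a) (B : ℝ) :
    Integrable (fun x : ℝ => Real.exp (-a * x ^ 2 + B * |x|)) := by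
  refine ((integrable_exp_neg_mul_sq (half_pos ha)).const_mul (Real.exp (B ^ 2 / (2 * a)))).mono'
    (by fun_prop) (.of_forall fun x => ?_)
  rw [Real.norm_of_nonneg (Real.exp_pos _).le, ← Real.exp_add, Real.exp_le_exp]
  have h : B ^ 2 / (2 * a) + -(a / 2) * x ^ 2 - (-a * x ^ 2 + B * |x|) =
      (B - a * |x|) ^ 2 / (2 * a) := by
    field_simp
    rw [← sq_abs x]
    ring
  have : 0 ≤ (B - a * |x|) ^ 2 / (2 * a) := by positivity
  linarith

theorem integrable_exp_quad_gaussianReal (b : ℝ) {v κ : ℝ} (hv : 0 < v) (hκ : κ < 1 / v)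
    (B δ : ℝ) :
    Integrable (fun x : ℝ => Real.exp (κ * x ^ 2 / 2 + B * |x| + δ))
      (gaussianReal b v.toNNReal) := by
  have hv0 : v.toNNReal ≠ 0 := by simpa using hv
  rw [gaussianReal_of_var_ne_zero b hv0, integrable_withDensity_iff_integrable_smul'
    (measurable_gaussianPDF _ _) (.of_forall fun _ => gaussianPDF_lt_top)]
  simp only [toReal_gaussianPDF, smul_eq_mul]
  refine ((integrable_exp_quad_add_abs (a := (1 / v - κ) / 2) (by linarith)
    (B + |b| / v)).const_mul ((√(2 * Real.pi * v))⁻¹ * Real.exp δ)).mono'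
    (by have := measurable_gaussianPDFReal b v.toNNReal
        fun_prop) (.of_forall fun x => ?_)
  rw [Real.norm_of_nonneg (mul_nonneg (gaussianPDFReal_nonneg _ _ _) (Real.exp_pos _).le),
    gaussianPDFReal, Real.coe_toNNReal _ hv.le, mul_assoc _ (Real.exp _) (Real.exp _),
    mul_assoc _ (Real.exp _) (Real.exp _), ← Real.exp_add, ← Real.exp_add]
  refine mul_le_mul_of_nonneg_left (Real.exp_le_exp.2 ?_) (by positivity)
  have h1 : b * x ≤ |b| * |x| := (le_abs_self _).trans_eq (abs_mul _ _)
  have h : δ + (-((1 / v - κ) / 2) * x ^ 2 + (B + |b| / v) * |x|) -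
      (-(x - b) ^ 2 / (2 * v) + (κ * x ^ 2 / 2 + B * |x| + δ)) =
      (2 * (|b| * |x| - b * x) + b ^ 2) / (2 * v) := by
    field_simp
    ring
  have : 0 ≤ (2 * (|b| * |x| - b * x) + b ^ 2) / (2 * v) :=
    div_nonneg (by nlinarith [sq_nonneg b]) (by positivity)
  linarith

theorem exists_gaussianReal_eq_withDensity (b b' : ℝ) {s v : ℝ} (hs : 0 < s) (hv : 0 < v) :
    ∃ β δ : ℝ, gaussianReal b s.toNNReal = (gaussianReal b' v.toNNReal).withDensity
      (fun x => ENNReal.ofReal (Real.exp ((1 / v - 1 / s) * x ^ 2 / 2 + β * x + δ))) := by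
  -- Coefficients of the difference of the Gaussian exponents; the logarithms account for the
  -- normalizing constants.
  refine ⟨b / s - b' / v, b' ^ 2 / (2 * v) - b ^ 2 / (2 * s) +
    (Real.log (√(2 * Real.pi * v)) - Real.log (√(2 * Real.pi * s))), ?_⟩
  rw [gaussianReal_of_var_ne_zero b (by simpa using hs),
    gaussianReal_of_var_ne_zero b' (by simpa using hv),
    ← withDensity_mul _ (measurable_gaussianPDF _ _) (by fun_prop)]
  congr 1
  ext x
  rw [Pi.mul_apply, gaussianPDF, gaussianPDF, ← ENNReal.ofReal_mul (gaussianPDFReal_nonneg _ _ _)]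
  congr 1
  rw [gaussianPDFReal, gaussianPDFReal, Real.coe_toNNReal _ hs.le, Real.coe_toNNReal _ hv.le,
    ← add_assoc, Real.exp_add, Real.exp_sub, Real.exp_log (by positivity),
    Real.exp_log (by positivity)]
  have h : -(x - b) ^ 2 / (2 * s) = -(x - b') ^ 2 / (2 * v) +
      ((1 / v - 1 / s) * x ^ 2 / 2 + (b / s - b' / v) * x +
        (b' ^ 2 / (2 * v) - b ^ 2 / (2 * s))) := by
    field_simp
    ring
  rw [h, Real.exp_add]
  have : √(2 * Real.pi * v) ≠ 0 := by positivity
  field_simp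

theorem integrable_quad_gaussianReal (b : ℝ) (v : NNReal) (c β δ : ℝ) :
    Integrable (fun x : ℝ => c * x ^ 2 / 2 + β * x + δ) (gaussianReal b v) :=
  ((((integrable_sq_gaussianReal b v).const_mul c).div_const 2).add
    ((integrable_id_gaussianReal b v).const_mul β)).add (integrable_const δ)

theorem integral_quad_gaussianReal (b : ℝ) (v : NNReal) (c β δ : ℝ) :
    ∫ x, (c * x ^ 2 / 2 + β * x + δ) ∂gaussianReal b v = c * (v + b ^ 2) / 2 + β * b + δ := by
  have h1 := ((integrable_sq_gaussianReal b v).const_mul c).div_const 2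
  have h2 := (integrable_id_gaussianReal b v).const_mul β
  have h3 : Integrable (fun x => c * x ^ 2 / 2 + β * x) (gaussianReal b v) := h1.add h2
  rw [integral_add h3 (integrable_const δ), integral_add h1 h2, integral_div,
    integral_const_mul, integral_const_mul, integral_sq_gaussianReal, integral_id_gaussianReal]
  simp

theorem relEntropy_eq_of_withDensity_exp {S : Type*} [MeasurableSpace S]
    {γ ν : ProbabilityMeasure S} {q : S → ℝ} (hq : Measurable q)
    (h : (γ : Measure S) = (ν : Measure S).withDensity fun x => ENNReal.ofReal (Real.exp (q x)))
    (hint : Integrable q (γ : Measure S)) :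
    relEntropy γ ν = ((∫ x, q x ∂(γ : Measure S) : ℝ) : EReal) := by
  have hac : (γ : Measure S) ≪ (ν : Measure S) := h ▸ withDensity_absolutelyContinuous _ _
  have hllr : llr (γ : Measure S) (ν : Measure S) =ᵐ[(γ : Measure S)] q := by
    refine hac.ae_le ?_
    have := Measure.rnDeriv_withDensity (ν : Measure S)
      (f := fun x => ENNReal.ofReal (Real.exp (q x))) (by fun_prop)
    rw [← h] at this
    filter_upwards [this] with x hx
    rw [llr, hx, ENNReal.toReal_ofReal (Real.exp_pos _).le, Real.log_exp]
  rw [relEntropy_eq_integral_llr (klDiv_ne_top hac (hint.congr hllr.symm)),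
    integral_congr_ae hllr]

theorem tendsto_integral_quadApprox (b : ℝ) (v : NNReal) (c β δ : ℝ) :
    Tendsto (fun t => ∫ x, quadApprox c β δ t x ∂gaussianReal b v) (𝓝[>] 0)
      (𝓝 (∫ x, (c * x ^ 2 / 2 + β * x + δ) ∂gaussianReal b v)) := by
  refine tendsto_integral_filter_of_dominated_convergence
    (fun x => |c| * x ^ 2 / 2 + |β| * |x| + |δ|)
    (.of_forall fun t => (quadApprox c β δ t).continuous.aestronglyMeasurable)
    (eventually_nhdsWithin_of_forall fun t ht => .of_forall fun x => abs_quadApprox_le c β δ ht x)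
    ?_ (.of_forall fun x => tendsto_quadApprox c β δ x)
  exact ((((integrable_sq_gaussianReal b v).const_mul |c|).div_const 2).add
    ((integrable_id_gaussianReal b v).abs.const_mul |β|)).add (integrable_const |δ|)

theorem tendsto_integral_exp_quadApprox (b : ℝ) {v : ℝ} (hv : 0 < v) {c : ℝ} (hc : c < 1 / v)
    (β δ : ℝ) {f : ℝ → ℝ} (hf : Measurable f) {C : ℝ} (hC : ∀ x, |f x| ≤ C) :
    Tendsto (fun t => ∫ x, Real.exp (quadApprox c β δ t x + f x) ∂gaussianReal b v.toNNReal)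
      (𝓝[>] 0) (𝓝 (∫ x, Real.exp (c * x ^ 2 / 2 + β * x + δ + f x)
        ∂gaussianReal b v.toNNReal)) := by
  refine tendsto_integral_filter_of_dominated_convergence
    (fun x => Real.exp (max c 0 * x ^ 2 / 2 + |β| * |x| + (δ + C)))
    (.of_forall fun t =>
      ((quadApprox c β δ t).continuous.measurable.add hf).exp.aestronglyMeasurable)
    (eventually_nhdsWithin_of_forall fun t ht => .of_forall fun x => ?_)
    (integrable_exp_quad_gaussianReal b hv (max_lt hc (by positivity)) _ _)
    (.of_forall fun x => ((tendsto_quadApprox c β δ x).add_const _).rexp)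
  rw [Real.norm_of_nonneg (Real.exp_pos _).le, Real.exp_le_exp]
  linarith [quadApprox_le (le_max_right c 0) (le_max_left c 0) β δ ht x, (abs_le.1 (hC x)).2]

/-! ### Uniqueness and optimality -/

/-- Probability measures are determined by their log-Laplace bounds on bounded functions. -/
theorem eq_of_integral_le_log_integral_exp {S : Type*} [MeasurableSpace S]
    {γ γ' : ProbabilityMeasure S}
    (h : ∀ f : S → ℝ, Measurable f → ∀ C : ℝ, (∀ x, |f x| ≤ C) →
      ∫ x, f x ∂(γ : Measure S) ≤ Real.log (∫ x, Real.exp (f x) ∂(γ' : Measure S))) :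
    γ = γ' := by
  have key : ∀ A : Set S, MeasurableSet A →
      (γ : Measure S).real A ≤ (γ' : Measure S).real A := by
    intro A hA
    have ht : ∀ t : ℝ, t ∈ Set.Ioo (0 : ℝ) 1 →
        (γ : Measure S).real A ≤ (1 + t) * (γ' : Measure S).real A := by
      rintro t ⟨ht0, ht1⟩
      -- Testing with t·1_A gives tp ≤ log(1 + p'(e^t - 1)) ≤ p'(t + t²); divide by t and let t → 0.
      have h1 := h (A.indicator fun _ => t) (measurable_const.indicator hA) t (fun x => by
        by_cases hx : x ∈ A <;> simp [hx, abs_of_pos ht0, ht0.le])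
      have h2 : (fun x => Real.exp (A.indicator (fun _ => t) x)) =
          fun x => 1 + A.indicator (fun _ => Real.exp t - 1) x := by
        ext x
        by_cases hx : x ∈ A <;> simp [hx]
      rw [h2, integral_add (integrable_const _) ((integrable_const _).indicator hA),
        integral_indicator_const _ hA, integral_indicator_const _ hA] at h1
      simp only [integral_const, probReal_univ, smul_eq_mul, mul_one] at h1
      set p := (γ : Measure S).real A
      set p' := (γ' : Measure S).real A
      have hp' : 0 ≤ p' := measureReal_nonneg
      have h3 : Real.exp t - 1 ≤ t + t ^ 2 := by
        have := Real.abs_exp_sub_one_sub_id_le (x := t) (by rw [abs_of_pos ht0]; exact ht1.le)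
        linarith [(abs_le.1 this).2]
      have h4 : 0 ≤ Real.exp t - 1 := by linarith [Real.add_one_le_exp t]
      have h5 := Real.log_le_sub_one_of_pos (x := 1 + p' * (Real.exp t - 1)) (by positivity)
      have h6 : p' * (Real.exp t - 1) ≤ p' * (t + t ^ 2) := by gcongr
      have h7 : t * p ≤ t * ((1 + t) * p') := by linarith
      exact le_of_mul_le_mul_left h7 ht0
    have hlim : Tendsto (fun t : ℝ => (1 + t) * (γ' : Measure S).real A) (𝓝[>] 0)
        (𝓝 ((1 + 0) * (γ' : Measure S).real A)) :=
      (Continuous.tendsto (by fun_prop) 0).mono_left nhdsWithin_le_nhds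
    have := ge_of_tendsto hlim (eventually_of_mem (Ioo_mem_nhdsGT zero_lt_one) ht)
    linarith
  apply Subtype.ext
  ext A hA
  refine (ENNReal.toReal_eq_toReal_iff' (measure_ne_top (γ : Measure S) A)
    (measure_ne_top (γ' : Measure S) A)).1 (le_antisymm (key A hA) ?_)
  have := key Aᶜ hA.compl
  rw [measureReal_compl hA, measureReal_compl hA] at this
  simp only [probReal_univ] at this
  change (γ' : Measure S).real A ≤ (γ : Measure S).real A
  linarith

/-- `hc` places q in Γ up to boundedness; `hus` is complementary slackness: q attains the bound |u -
s|/2 on W. -/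
theorem isOptimizer_normal (b b' : ℝ) {u v s : ℝ} (hu : 0 < u) (hv : 0 < v) (hs : 0 < s)
    (hc : |1 / v - 1 / s| ≤ 1) (hus : (1 / v - 1 / s) * (u - s) = |u - s|) :
    (IsOptimizer lipDerivClass (normal b u) (normal b' v) (normal b s) ∧
      ∀ γ, IsOptimizer lipDerivClass (normal b u) (normal b' v) γ → γ = normal b s) ∧
    divergence lipDerivClass (normal b u) (normal b' v) =
      objective lipDerivClass (normal b u) (normal b' v) (normal b s) := by
  obtain ⟨β, δ, hdens⟩ := exists_gaussianReal_eq_withDensity b b' hs hv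
  set c := 1 / v - 1 / s with hcdef
  have hcv : c < 1 / v := by
    have : 0 < 1 / s := by positivity
    linarith
  set D : ℝ := ∫ x, (c * x ^ 2 / 2 + β * x + δ) ∂gaussianReal b u.toNNReal with hD
  have hup : objective lipDerivClass (normal b u) (normal b' v) (normal b s) ≤ (D : EReal) := by
    have h1 := relEntropy_eq_of_withDensity_exp (γ := normal b s) (ν := normal b' v)
      (q := fun x => c * x ^ 2 / 2 + β * x + δ) (by fun_prop) hdens
      (integrable_quad_gaussianReal b s.toNNReal c β δ)
    have h2 := W_normal_le b hu.le hs.le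
    unfold objective
    rw [h1]
    refine (add_le_add le_rfl h2).trans_eq ?_
    rw [← EReal.coe_add, hD, integral_quad_gaussianReal]
    change ((∫ x, (c * x ^ 2 / 2 + β * x + δ) ∂gaussianReal b s.toNNReal + |u - s| / 2 : ℝ) :
      EReal) = _
    rw [integral_quad_gaussianReal, Real.coe_toNNReal _ hu.le, Real.coe_toNNReal _ hs.le, ← hus]
    congr 1
    ring
  have hexp : ∀ f : ℝ → ℝ,
      ∫ x, Real.exp (c * x ^ 2 / 2 + β * x + δ + f x) ∂gaussianReal b' v.toNNReal =
        ∫ x, Real.exp (f x) ∂gaussianReal b s.toNNReal := by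
    intro f
    rw [hdens, integral_withDensity_eq_integral_toReal_smul (by fun_prop)
      (.of_forall fun _ => ENNReal.ofReal_lt_top)]
    refine integral_congr_ae (.of_forall fun x => ?_)
    simp only [smul_eq_mul]
    rw [ENNReal.toReal_ofReal (Real.exp_pos _).le, Real.exp_add]
  have htend : ∀ f : ℝ → ℝ, Measurable f → ∀ C : ℝ, (∀ x, |f x| ≤ C) → ∀ r : ℝ,
      Tendsto (fun t => ((r + ∫ x, quadApprox c β δ t x ∂gaussianReal b u.toNNReal -
        Real.log (∫ x, Real.exp (quadApprox c β δ t x + f x) ∂gaussianReal b' v.toNNReal) : ℝ) :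
          EReal)) (𝓝[>] 0)
        (𝓝 ((r + D - Real.log (∫ x, Real.exp (f x) ∂gaussianReal b s.toNNReal) : ℝ) : EReal)) := by
    intro f hf C hC r
    refine (continuous_coe_real_ereal.tendsto _).comp
      (((tendsto_integral_quadApprox b u.toNNReal c β δ).const_add r).sub (Tendsto.log ?_ ?_))
    · rw [← hexp]
      exact tendsto_integral_exp_quadApprox b' hv hcv β δ hf hC
    · refine (integral_exp_pos ?_).ne'
      exact .of_bound hf.exp.aestronglyMeasurable (Real.exp C) (.of_forall fun x => by
        rw [Real.norm_of_nonneg (Real.exp_pos _).le]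
        exact Real.exp_le_exp.2 ((le_abs_self _).trans (hC x)))
  have hlow : ∀ γ : ProbabilityMeasure ℝ, ∀ f : ℝ → ℝ, Measurable f → ∀ C : ℝ,
      (∀ x, |f x| ≤ C) →
      ((∫ x, f x ∂(γ : Measure ℝ) + D -
        Real.log (∫ x, Real.exp (f x) ∂gaussianReal b s.toNNReal) : ℝ) : EReal) ≤
        objective lipDerivClass (normal b u) (normal b' v) γ := fun γ f hf C hC =>
    le_of_tendsto (htend f hf C hC _) (eventually_nhdsWithin_of_forall fun t ht =>
      le_objective (normal b u) (normal b' v) γ (quadApprox_mem hc β δ ht) hf hC)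
  have hlow0 : ∀ γ : ProbabilityMeasure ℝ,
      (D : EReal) ≤ objective lipDerivClass (normal b u) (normal b' v) γ := fun γ => by
    simpa using hlow γ (fun _ => 0) measurable_const 0 (by simp)
  have hdiv_ge : (D : EReal) ≤ divergence lipDerivClass (normal b u) (normal b' v) := by
    have h := htend (fun _ => 0) measurable_const 0 (by simp) 0
    simp only [add_zero, zero_add, Real.exp_zero, integral_const, probReal_univ, smul_eq_mul,
      mul_one, Real.log_one, sub_zero] at h
    exact le_of_tendsto h (eventually_nhdsWithin_of_forall fun t ht =>
      le_iSup₂_of_le _ (quadApprox_mem hc β δ ht) le_rfl)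
  have hdiv_le : divergence lipDerivClass (normal b u) (normal b' v) ≤
      objective lipDerivClass (normal b u) (normal b' v) (normal b s) :=
    iSup₂_le fun g hg => by
      simpa using le_objective (normal b u) (normal b' v) (normal b s) hg
        (f := fun _ => 0) measurable_const (C := 0) (by simp)
  refine ⟨⟨fun γ => hup.trans (hlow0 γ), fun γ hγ => ?_⟩,
    le_antisymm hdiv_le (hup.trans hdiv_ge)⟩
  refine eq_of_integral_le_log_integral_exp fun f hf C hC => ?_
  -- An optimizer has objective at most D, so D cancels from the lower bound.
  have h := EReal.coe_le_coe_iff.1 ((hlow γ f hf C hC).trans ((hγ (normal b s)).trans hup))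
  change _ ≤ Real.log (∫ x, Real.exp (f x) ∂gaussianReal b s.toNNReal)
  linarith

theorem W_self (μ : ProbabilityMeasure ℝ) : W lipDerivClass μ μ = 0 := by
  refine le_antisymm (iSup₂_le fun g _ => by simp) ?_
  refine le_iSup₂_of_le 0 ⟨contDiff_const, ?_⟩ (by simp)
  have : deriv (⇑(0 : ℝ →ᵇ ℝ)) = fun _ => 0 := by
    ext x
    exact deriv_const x 0
  rw [this]
  exact LipschitzWith.const' 0

end GammaDivergence

end

/-! ### The three variance regimes -/

theorem mainTheorem10 (b₁ b₂ σ₁ σ₂ : ℝ) (hσ₁ : 0 < σ₁) (hσ₂ : 0 < σ₂)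
    (μ ν : ProbabilityMeasure ℝ)
    (hμ : μ = GammaDivergence.normal b₁ (σ₁ ^ 2))
    (hν : ν = GammaDivergence.normal b₂ (σ₂ ^ 2)) :
    ∃ γstar : ProbabilityMeasure ℝ,
      (GammaDivergence.IsOptimizer GammaDivergence.lipDerivClass μ ν γstar ∧
        ∀ γ : ProbabilityMeasure ℝ,
          GammaDivergence.IsOptimizer GammaDivergence.lipDerivClass μ ν γ → γ = γstar) ∧
      GammaDivergence.divergence GammaDivergence.lipDerivClass μ ν =
        GammaDivergence.objective GammaDivergence.lipDerivClass μ ν γstar ∧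
      (|1 / σ₁ ^ 2 - 1 / σ₂ ^ 2| ≤ 1 →
        γstar = μ ∧
        GammaDivergence.divergence GammaDivergence.lipDerivClass μ ν =
          GammaDivergence.relEntropy μ ν) ∧
      (1 / σ₁ ^ 2 - 1 / σ₂ ^ 2 > 1 →
        γstar = GammaDivergence.normal b₁ (σ₂ ^ 2 / (1 + σ₂ ^ 2))) ∧
      (1 / σ₁ ^ 2 - 1 / σ₂ ^ 2 < -1 →
        γstar = GammaDivergence.normal b₁ (σ₂ ^ 2 / (1 - σ₂ ^ 2))) := by
  subst hμ hν
  have hu : 0 < σ₁ ^ 2 := by positivity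
  have hv : 0 < σ₂ ^ 2 := by positivity
  generalize σ₁ ^ 2 = u at hu ⊢
  generalize σ₂ ^ 2 = v at hv ⊢
  have hu' : 0 < 1 / u := by positivity
  rcases le_or_gt |1 / u - 1 / v| 1 with h | h
  · obtain ⟨h1, h2⟩ := GammaDivergence.isOptimizer_normal b₁ b₂ hu hv hu
      (by rwa [abs_sub_comm]) (by simp)
    obtain ⟨h3, h4⟩ := abs_le.1 h
    refine ⟨_, h1, h2, fun _ => ⟨rfl, ?_⟩, fun _ => by linarith, fun _ => by linarith⟩
    rw [h2, GammaDivergence.objective, GammaDivergence.W_self, add_zero]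
  · rcases lt_abs.1 h with h' | h'
    · have hs : 0 < v / (1 + v) := by positivity
      have hinv : 1 / (v / (1 + v)) = 1 / v + 1 := by field_simp
      have hlt : u < v / (1 + v) := (one_div_lt_one_div hs hu).1 (by linarith)
      obtain ⟨h1, h2⟩ := GammaDivergence.isOptimizer_normal b₁ b₂ hu hv hs
        (by rw [hinv]; simp) (by rw [hinv, abs_of_neg (by linarith)]; ring)
      exact ⟨_, h1, h2, fun _ => by linarith, fun _ => rfl, fun _ => by linarith⟩
    · have hv1 : 0 < 1 - v := by
        -- Since 1/v > 1 + 1/u, the variance v/(1 - v) is positive.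
        have : 1 < 1 / v := by linarith
        rw [lt_div_iff₀ hv] at this
        linarith
      have hs : 0 < v / (1 - v) := by positivity
      have hinv : 1 / (v / (1 - v)) = 1 / v - 1 := by field_simp
      have hlt : v / (1 - v) < u := (one_div_lt_one_div hu hs).1 (by linarith)
      obtain ⟨h1, h2⟩ := GammaDivergence.isOptimizer_normal b₁ b₂ hu hv hs
        (by rw [hinv]; simp) (by rw [hinv, abs_of_pos (by linarith)]; ring)
      exact ⟨_, h1, h2, fun _ => by linarith, fun _ => by linarith, fun _ => rfl⟩
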